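/- For $n\ge 1$ let $m=\phi(n)$, let $\zeta_{n,1},\dots,\zeta_{n,m}$ be the primitive $n$-th roots of unity in $\mathbb{C}$, let $V_{\Phi_n}=(\zeta_{n,i}^{\,j})_{1\le i\le m,\;0\le j\le m-1}$ be the Vandermonde matrix of the cyclotomic polynomial $\Phi_n$, and let $\omega(n)$ be the number of distinct prime divisors of $n$. For a prime $p$ put $$V_p=\begin{pmatrix}1&\sqrt p\\1&-\sqrt p\end{pmatrix}\ \text{ if } p\equiv 2,3 \pmod 4,\qquad V_p=\begin{pmatrix}1&\frac{1+\sqrt p}{2}\\1&\frac{1-\sqrt p}{2}\end{pmatrix}\ \text{ if } p\equiv 1\pmod 4 .$$ Let $p_i$ be the $i$-th prime number, and for $r\ge 0$ let $$T'V_{n,r}=V_{\Phi_n}\otimes V_{p_1}\otimes\cdots\otimes V_{p_r}$$ (Kronecker product), an invertible matrix of size $2^r m$. (When $p_1,\dots,p_r\nmid n$, this is the matrix $T'V_K$ of the hybrid embedding of $K=\mathbb{Q}(\zeta_n,\sqrt{p_1},\dots,\sqrt{p_r})$, a field of degree $2^r m$.) For an invertible complex matrix $A$ let $\mathrm{Cond}(A)=\|A\|\,\|A^{-1}\|$,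 where $\|\cdot\|$ is the Frobenius norm. **Theorem.** Let $(n,r)$ range over a family of pairs, with a limit taken along the family (for instance a sequence of pairs $(n_j,r_j)$ as $j\to\infty$; in general, any filter on the index set), such that $m=\phi(n)\to\infty$ and $$\frac{r\log\sqrt{r\log r}}{\log m}\longrightarrow 0 ,$$ where the numerator is read as $0$ if $r\in\{0,1\}$ (it is allowed, but not required, that $r\to\infty$). Then, along this limit: - if eventually $\omega(n)\le 3$, then $\mathrm{Cond}(T'V_{n,r})=O\big((2^r m)^{2+\omega(n)-1}\big)$; - if eventually $\omega(n)=4$, then $\mathrm{Cond}(T'V_{n,r})=O\big((2^r m)^{6}\big)$; - if eventually $\omega(n)=5$, then $\mathrm{Cond}(T'V_{n,r})=O\big((2^r m)^{9}\big)$; - if eventually $\omega(n)=6$, then $\mathrm{Cond}(T'V_{n,r})=O\big((2^r m)^{13}\big)$. -/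

import Mathlib

open Filter Topology Asymptotics
open scoped Kronecker Matrix.Norms.Frobenius

noncomputable section

namespace CycloMultiquadratic

/-- The condition number `‖A‖ ‖A⁻¹‖` of a complex square matrix, where `‖·‖` is the Frobenius
norm. It is meant for invertible `A`; invertibility of the matrices to which it is applied is
proved below. -/
def condNumber {ι : Type*} [Fintype ι] [DecidableEq ι] (A : Matrix ι ι ℂ) : ℝ :=
  ‖A‖ * ‖A⁻¹‖

/-- The `k`-th element, in increasing order, of the set of all `a < n` coprime to `n`. -/
def totative (n : ℕ) (k : Fin n.totient) : ℕ :=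
  ((Finset.range n).filter n.Coprime).orderEmbOfFin rfl k

/-- The primitive `n`-th roots of unity `ζ_{n,1}, …, ζ_{n,m}`, `m = φ(n)`, i.e. the roots
of the cyclotomic polynomial `Φ_n`. -/
def cycloRoot (n : ℕ) (k : Fin n.totient) : ℂ :=
  Complex.exp (2 * Real.pi * Complex.I * ((totative n k : ℂ) / (n : ℂ)))

/-- The Vandermonde matrix `V_{Φ_n} = (ζ_{n,i} ^ j)`, `0 ≤ j < φ(n)`, of the power basis. -/
def cycloVandermonde (n : ℕ) : Matrix (Fin n.totient) (Fin n.totient) ℂ :=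
  Matrix.vandermonde (cycloRoot n)

/-- The matrix `V_p` of the quadratic field `ℚ(√p)`: the Vandermonde matrix of the two
conjugates of the generator `√p` (if `p ≡ 2, 3 mod 4`) or `(1 + √p) / 2` (if `p ≡ 1 mod 4`) of
its ring of integers. -/
def quadMatrix (p : ℕ) : Matrix (Fin 2) (Fin 2) ℂ :=
  if p % 4 = 1 then
    !![1, (1 + (Real.sqrt p : ℂ)) / 2; 1, (1 - (Real.sqrt p : ℂ)) / 2]
  else
    !![1, (Real.sqrt p : ℂ); 1, -(Real.sqrt p : ℂ)]

/-- The index set `Fin (φ n) × Fin 2 × ⋯ × Fin 2` (with `r` factors `Fin 2`). -/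
def HybridIndex (n : ℕ) : ℕ → Type
  | 0 => Fin n.totient
  | r + 1 => HybridIndex n r × Fin 2

instance instFintypeHybridIndex (n : ℕ) : (r : ℕ) → Fintype (HybridIndex n r)
  | 0 => inferInstanceAs (Fintype (Fin n.totient))
  | r + 1 =>
    letI := instFintypeHybridIndex n r
    inferInstanceAs (Fintype (HybridIndex n r × Fin 2))

instance instDecidableEqHybridIndex (n : ℕ) : (r : ℕ) → DecidableEq (HybridIndex n r)
  | 0 => inferInstanceAs (DecidableEq (Fin n.totient))
  | r + 1 =>
    letI := instDecidableEqHybridIndex n r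
    inferInstanceAs (DecidableEq (HybridIndex n r × Fin 2))

/-- The hybrid matrix `V_{Φ_n} ⊗ V_{p_1} ⊗ ⋯ ⊗ V_{p_r}`, where `p_i` is the `i`-th prime
number (`Nat.nth Nat.Prime` counts from zero, so `p_{r+1}` is `Nat.nth Nat.Prime r`). -/
def hybridMatrix (n : ℕ) : (r : ℕ) → Matrix (HybridIndex n r) (HybridIndex n r) ℂ
  | 0 => cycloVandermonde n
  | r + 1 => hybridMatrix n r ⊗ₖ quadMatrix (Nat.nth Nat.Prime r)

theorem condNumber_hybridMatrix_zero (n : ℕ) :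
    condNumber (hybridMatrix n 0) = condNumber (cycloVandermonde n) := rfl

theorem condNumber_hybridMatrix_succ (n r : ℕ) :
    condNumber (hybridMatrix n (r + 1)) =
      condNumber (hybridMatrix n r ⊗ₖ quadMatrix (Nat.nth Nat.Prime r)) := rfl

theorem card_hybridIndex (n r : ℕ) :
    Fintype.card (HybridIndex n r) = 2 ^ r * n.totient := by
  induction r with
  | zero => exact (Fintype.card_fin _).trans (by simp)
  | succ r ih =>
    have h : Fintype.card (HybridIndex n (r + 1)) =
        Fintype.card (HybridIndex n r × Fin 2) := rfl
    rw [h, Fintype.card_prod, ih, Fintype.card_fin]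
    ring

theorem totative_mem (n : ℕ) (k : Fin n.totient) :
    totative n k < n ∧ n.Coprime (totative n k) := by
  have h := Finset.orderEmbOfFin_mem ((Finset.range n).filter n.Coprime) rfl k
  simpa [totative] using h

theorem isPrimitiveRoot_cycloRoot (n : ℕ) (k : Fin n.totient) :
    IsPrimitiveRoot (cycloRoot n k) n := by
  have h := totative_mem n k
  exact Complex.isPrimitiveRoot_exp_of_coprime _ n (by omega) h.2.symm

theorem cycloRoot_injective (n : ℕ) : Function.Injective (cycloRoot n) := by
  intro a b hab
  have ha := totative_mem n a
  have hb := totative_mem n b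
  have hn : n ≠ 0 := by omega
  have key : ∀ c : Fin n.totient, cycloRoot n c =
      Complex.exp (2 * Real.pi * Complex.I / n) ^ totative n c := by
    intro c
    rw [← Complex.exp_nat_mul, cycloRoot]
    congr 1
    ring
  rw [key, key] at hab
  have h := (Complex.isPrimitiveRoot_exp n hn).pow_inj ha.1 hb.1 hab
  exact (Finset.orderEmbOfFin _ rfl).injective h

theorem isUnit_det_cycloVandermonde (n : ℕ) : IsUnit (cycloVandermonde n).det :=
  isUnit_iff_ne_zero.2 (Matrix.det_vandermonde_ne_zero_iff.2 (cycloRoot_injective n))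

theorem isUnit_det_quadMatrix {p : ℕ} (hp : 0 < p) : IsUnit (quadMatrix p).det := by
  have h0 : (Real.sqrt p : ℂ) ≠ 0 := by
    exact_mod_cast (Real.sqrt_pos.2 (by exact_mod_cast hp)).ne'
  rw [isUnit_iff_ne_zero, quadMatrix]
  split_ifs
  · rw [Matrix.det_fin_two_of]
    intro h
    apply h0
    linear_combination -h
  · rw [Matrix.det_fin_two_of]
    intro h
    apply h0
    linear_combination -h / 2

/-- The hybrid matrix is invertible, so that its condition number makes sense. -/
theorem isUnit_det_hybridMatrix (n r : ℕ) : IsUnit (hybridMatrix n r).det := by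
  induction r with
  | zero => exact isUnit_det_cycloVandermonde n
  | succ r ih =>
    have hp : 0 < Nat.nth Nat.Prime r := (Nat.prime_nth_prime r).pos
    have h : (hybridMatrix n (r + 1)).det =
        (hybridMatrix n r ⊗ₖ quadMatrix (Nat.nth Nat.Prime r)).det := rfl
    rw [h, Matrix.det_kronecker]
    exact (ih.pow _).mul ((isUnit_det_quadMatrix hp).pow _)

end CycloMultiquadratic

end

namespace CycloMultiquadratic

/-! The Frobenius norm, hence the condition number, is multiplicative on Kronecker products, and
`Cond(V_p) ≤ 2√p`. So `Cond(T'V_{n,r}) ≤ Cond(V_{Φ_n}) · 2^r · √(p_1⋯p_r)`, and the growth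
hypothesis on `r` makes `p_1⋯p_r ≤ m` eventually (`eventually_prod_nth_prime_le`). What remains is
`Cond(V_{Φ_n})`.

Let `a` bound the coefficients of `Φ_n` and let `s` bound the ℓ¹ norm of `Ψ = (X^n - 1)/Φ_n`.
Lagrange interpolation, the identity `Φ_n'(ζ)Ψ(ζ) = nζ^(n-1)` and Parseval over all `n`-th roots of
unity give `Cond(V_{Φ_n}) ≤ m^(3/2) · a · s` (`CycloBound.condNumber_cycloVandermonde_le`).

The product `a · s` is controlled by adding primes one at a time. A repeated prime changes nothing;
a new prime `p` turns `(a, s)` for `N` into `(as, saN)` for `Np`, so `as` becomes `(as)²N`. If `p`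
is the largest of `k + 1` primes, then `N ≤ n^(k/(k+1))`, hence `as = O(n^t)` with `t` given by the
recursion `cycloExponent`. Since `n ≤ 2^ω(n) m`, altogether `Cond = O(2^r m^(2+t))`, and `2 + t` is
at most the claimed exponent. -/

/-! ### Condition numbers of Kronecker products and of the quadratic factors. -/

theorem frobenius_norm_sq {ι κ : Type*} [Fintype ι] [Fintype κ] (A : Matrix ι κ ℂ) :
    ‖A‖ ^ 2 = ∑ i, ∑ j, ‖A i j‖ ^ 2 := by
  rw [Matrix.frobenius_norm_def, ← Real.sqrt_eq_rpow, Real.sq_sqrt (by positivity)]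
  simp

theorem frobenius_norm_kronecker {ι κ ι' κ' : Type*} [Fintype ι] [Fintype κ] [Fintype ι']
    [Fintype κ'] (A : Matrix ι κ ℂ) (B : Matrix ι' κ' ℂ) : ‖A ⊗ₖ B‖ = ‖A‖ * ‖B‖ := by
  rw [← sq_eq_sq₀ (norm_nonneg _) (by positivity), mul_pow, frobenius_norm_sq,
    frobenius_norm_sq, frobenius_norm_sq]
  simp only [Fintype.sum_prod_type, Matrix.kroneckerMap_apply, norm_mul, mul_pow,
    Finset.sum_mul_sum]

theorem condNumber_nonneg {ι : Type*} [Fintype ι] [DecidableEq ι] (A : Matrix ι ι ℂ) :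
    0 ≤ condNumber A := by
  unfold condNumber; positivity

theorem condNumber_kronecker {ι κ : Type*} [Fintype ι] [DecidableEq ι] [Fintype κ]
    [DecidableEq κ] (A : Matrix ι ι ℂ) (B : Matrix κ κ ℂ) :
    condNumber (A ⊗ₖ B) = condNumber A * condNumber B := by
  simp only [condNumber, Matrix.inv_kronecker, frobenius_norm_kronecker]
  ring

theorem condNumber_fin_two (A : Matrix (Fin 2) (Fin 2) ℂ) :
    condNumber A = ‖A‖ ^ 2 / ‖A.det‖ := by
  -- In size two the adjugate only permutes the entries and changes signs.
  have h : ‖A.adjugate‖ = ‖A‖ := by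
    rw [← sq_eq_sq₀ (norm_nonneg _) (norm_nonneg _), frobenius_norm_sq, frobenius_norm_sq,
      Matrix.adjugate_fin_two]
    simp [Fin.sum_univ_two]
    ring
  rw [condNumber, Matrix.inv_def, Ring.inverse_eq_inv', norm_smul, h, norm_inv]
  ring

theorem condNumber_quadMatrix_le {p : ℕ} (hp : 2 ≤ p) :
    condNumber (quadMatrix p) ≤ 2 * Real.sqrt p := by
  have hp' : (2 : ℝ) ≤ p := by exact_mod_cast hp
  have hs : 0 < Real.sqrt p := Real.sqrt_pos.2 (by linarith)
  have hs2 : Real.sqrt p ^ 2 = p := Real.sq_sqrt (by linarith)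
  have hs2' : Real.sqrt p * Real.sqrt p = p := Real.mul_self_sqrt (by linarith)
  rw [condNumber_fin_two, frobenius_norm_sq, quadMatrix]
  split_ifs
  · have e1 : ‖(1 + (Real.sqrt p : ℂ)) / 2‖ ^ 2 = ((1 + Real.sqrt p) / 2) ^ 2 := by
      rw [← sq_abs ((1 + Real.sqrt p) / 2), ← Real.norm_eq_abs, ← Complex.norm_real]
      push_cast; rfl
    have e2 : ‖(1 - (Real.sqrt p : ℂ)) / 2‖ ^ 2 = ((1 - Real.sqrt p) / 2) ^ 2 := by
      rw [← sq_abs ((1 - Real.sqrt p) / 2), ← Real.norm_eq_abs, ← Complex.norm_real]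
      push_cast; rfl
    have e3 : (!![1, (1 + (Real.sqrt p : ℂ)) / 2; 1, (1 - (Real.sqrt p : ℂ)) / 2]).det
        = ((-Real.sqrt p : ℝ) : ℂ) := by
      rw [Matrix.det_fin_two_of]; push_cast; ring
    rw [e3, Complex.norm_real, norm_neg, Real.norm_of_nonneg hs.le, div_le_iff₀ hs]
    simp only [Fin.sum_univ_two, Matrix.of_apply, Matrix.cons_val_zero, Matrix.cons_val_one,
      Matrix.cons_val', Matrix.cons_val_fin_one, norm_one, e1, e2]
    nlinarith
  · have e3 : (!![1, (Real.sqrt p : ℂ); 1, -(Real.sqrt p : ℂ)]).det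
        = ((-(2 * Real.sqrt p) : ℝ) : ℂ) := by
      rw [Matrix.det_fin_two_of]; push_cast; ring
    rw [e3, Complex.norm_real, norm_neg, Real.norm_of_nonneg (by positivity),
      div_le_iff₀ (by positivity)]
    simp only [Fin.sum_univ_two, Matrix.of_apply, Matrix.cons_val_zero, Matrix.cons_val_one,
      Matrix.cons_val', Matrix.cons_val_fin_one, norm_one, norm_neg, Complex.norm_real,
      Real.norm_of_nonneg hs.le]
    nlinarith

theorem condNumber_hybridMatrix_le (n r : ℕ) :
    condNumber (hybridMatrix n r) ≤ condNumber (cycloVandermonde n) *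
      (2 ^ r * Real.sqrt (∏ i ∈ Finset.range r, (Nat.nth Nat.Prime i : ℝ))) := by
  induction r with
  | zero => simp [condNumber_hybridMatrix_zero]
  | succ r ih =>
    rw [condNumber_hybridMatrix_succ, condNumber_kronecker, Finset.prod_range_succ,
      Real.sqrt_mul (by positivity), pow_succ]
    refine (mul_le_mul ih (condNumber_quadMatrix_le (Nat.prime_nth_prime r).two_le)
      (condNumber_nonneg _) ?_).trans_eq (by ring)
    have := condNumber_nonneg (cycloVandermonde n)
    positivity

/-! ### Coefficient bounds for cyclotomic polynomials and their cofactors. -/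

open Polynomial

/-- The sum of the absolute values of the coefficients of an integer polynomial. -/
def l1Norm (P : ℤ[X]) : ℤ := P.sum fun _ c => |c|

theorem l1Norm_eq_sum_of_subset (P : ℤ[X]) {s : Finset ℕ} (h : P.support ⊆ s) :
    l1Norm P = ∑ i ∈ s, |P.coeff i| :=
  Polynomial.sum_eq_of_subset _ (by simp) h

theorem l1Norm_nonneg (P : ℤ[X]) : 0 ≤ l1Norm P :=
  Finset.sum_nonneg fun _ _ => abs_nonneg _

theorem l1Norm_zero : l1Norm 0 = 0 := by simp [l1Norm]

theorem l1Norm_add_le (P Q : ℤ[X]) : l1Norm (P + Q) ≤ l1Norm P + l1Norm Q := by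
  rw [l1Norm_eq_sum_of_subset P (s := P.support ∪ Q.support) Finset.subset_union_left,
    l1Norm_eq_sum_of_subset Q (s := P.support ∪ Q.support) Finset.subset_union_right,
    l1Norm_eq_sum_of_subset (P + Q) support_add, ← Finset.sum_add_distrib]
  exact Finset.sum_le_sum fun i _ => by rw [coeff_add]; exact abs_add_le _ _

theorem l1Norm_sum_le {ι : Type*} (s : Finset ι) (f : ι → ℤ[X]) :
    l1Norm (∑ i ∈ s, f i) ≤ ∑ i ∈ s, l1Norm (f i) :=
  Finset.le_sum_of_subadditive l1Norm l1Norm_zero.le l1Norm_add_le s f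

theorem l1Norm_monomial (k : ℕ) (c : ℤ) : l1Norm (monomial k c) = |c| :=
  Polynomial.sum_monomial_index _ _ (by simp)

theorem l1Norm_mul_le (P Q : ℤ[X]) : l1Norm (P * Q) ≤ l1Norm P * l1Norm Q := by
  rw [Polynomial.mul_eq_sum_sum]
  refine (l1Norm_sum_le _ _).trans ?_
  rw [l1Norm, Polynomial.sum, Finset.sum_mul]
  refine Finset.sum_le_sum fun i _ => (l1Norm_sum_le _ _).trans ?_
  simp only [l1Norm_monomial, abs_mul]
  rw [← Finset.mul_sum]
  rfl

theorem l1Norm_expand {p : ℕ} (hp : 0 < p) (P : ℤ[X]) : l1Norm (expand ℤ p P) = l1Norm P := by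
  have h : (expand ℤ p P).support ⊆ P.support.image (· * p) := by
    intro i hi
    rw [mem_support_iff, coeff_expand hp] at hi
    split_ifs at hi with hd
    · exact Finset.mem_image.2 ⟨i / p, mem_support_iff.2 hi, Nat.div_mul_cancel hd⟩
    · exact absurd rfl hi
  rw [l1Norm_eq_sum_of_subset _ h, Finset.sum_image fun a _ b _ e => Nat.eq_of_mul_eq_mul_right hp e]
  simp only [coeff_expand_mul hp]
  rfl

theorem l1Norm_le_mul_of_coeff_le {P : ℤ[X]} {a : ℤ} (h : ∀ i, |P.coeff i| ≤ a) :
    l1Norm P ≤ (P.natDegree + 1) * a := by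
  rw [l1Norm_eq_sum_of_subset P supp_subset_range_natDegree_succ]
  exact (Finset.sum_le_card_nsmul _ _ _ fun i _ => h i).trans (by simp)

theorem abs_coeff_mul_le {P Q : ℤ[X]} {a : ℤ} (h : ∀ i, |P.coeff i| ≤ a) (k : ℕ) :
    |(P * Q).coeff k| ≤ a * l1Norm Q := by
  have ha : 0 ≤ a := (abs_nonneg _).trans (h 0)
  have hQ : (P * Q).coeff k = ∑ j ∈ Q.support, (P * monomial j (Q.coeff j)).coeff k := by
    conv_lhs => rw [Q.as_sum_support, Finset.mul_sum, finsetSum_coeff]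
  rw [hQ, l1Norm, Polynomial.sum, Finset.mul_sum]
  refine (Finset.abs_sum_le_sum_abs _ _).trans (Finset.sum_le_sum fun j _ => ?_)
  rw [← C_mul_X_pow_eq_monomial, mul_comm (C _), ← mul_assoc, coeff_mul_C, coeff_mul_X_pow',
    abs_mul]
  refine mul_le_mul_of_nonneg_right ?_ (abs_nonneg _)
  split_ifs
  · exact h _
  · simpa using ha

/-- `a` bounds the absolute values of the coefficients of the `n`-th cyclotomic polynomial
`Φ_n`, and `s` bounds the sum of those of the cofactor `(X ^ n - 1) / Φ_n`. -/
def CycloBound (n : ℕ) (a s : ℤ) : Prop :=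
  (∀ i, |(cyclotomic n ℤ).coeff i| ≤ a) ∧
    ∃ Ψ : ℤ[X], cyclotomic n ℤ * Ψ = X ^ n - 1 ∧ l1Norm Ψ ≤ s

theorem cycloBound_prime {p : ℕ} (hp : p.Prime) : CycloBound p 1 2 := by
  have := Fact.mk hp
  refine ⟨fun i => ?_, X - 1, cyclotomic_prime_mul_X_sub_one ℤ p, ?_⟩
  · rw [cyclotomic_prime, finsetSum_coeff]
    simp only [coeff_X_pow, Finset.sum_ite_eq, Finset.mem_range]
    split_ifs <;> simp
  · have h : (X - 1 : ℤ[X]) = monomial 1 1 + monomial 0 (-1) := by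
      rw [monomial_zero_left, ← X_pow_eq_monomial]; simp [sub_eq_add_neg]
    rw [h]
    refine (l1Norm_add_le _ _).trans ?_
    rw [l1Norm_monomial, l1Norm_monomial]
    norm_num

/-- Here `Φ_{Np}(X) = Φ_N(X^p)`, and substituting `X^p` only spreads the coefficients out, for the
cofactor as well. -/
theorem CycloBound.mul_prime_of_dvd {N p : ℕ} {a s : ℤ} (h : CycloBound N a s) (hp : p.Prime)
    (hd : p ∣ N) : CycloBound (N * p) a s := by
  obtain ⟨h1, Ψ, h2, h3⟩ := h
  have he := cyclotomic_expand_eq_cyclotomic hp hd ℤ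
  refine ⟨fun i => ?_, expand ℤ p Ψ, ?_, (l1Norm_expand hp.pos Ψ).trans_le h3⟩
  · rw [← he, coeff_expand hp.pos]
    split_ifs
    · exact h1 _
    · simpa using (abs_nonneg _).trans (h1 0)
  · rw [← he, ← map_mul, h2]
    simp only [map_sub, map_pow, expand_X, map_one]
    ring

/-- No cancellation or accumulation occurs: an exponent `u = pj + Ni` with `j < N` determines `j`
modulo `N`, as `p` is invertible there, hence `j` and then `i`. So each coefficient of the product
is a single coefficient of `P` or zero. -/
theorem abs_coeff_expand_mul_geom_le {N p M : ℕ} {a : ℤ} {P : ℤ[X]} (hp : 0 < p)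
    (hNp : N.Coprime p) (hdeg : P.natDegree < N) (h : ∀ i, |P.coeff i| ≤ a) (u : ℕ) :
    |(expand ℤ p P * ∑ i ∈ Finset.range M, (X ^ N) ^ i).coeff u| ≤ a := by
  have ha : 0 ≤ a := (abs_nonneg _).trans (h 0)
  have hN : 0 < N := by omega
  simp only [Finset.mul_sum, finsetSum_coeff, ← pow_mul, coeff_mul_X_pow', coeff_expand hp]
  have key : ∀ i ∈ Finset.range M, (if N * i ≤ u then
      if p ∣ u - N * i then P.coeff ((u - N * i) / p) else 0 else 0) ≠ 0 →
      ∃ j < N, u = p * j + N * i := by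
    intro i _ hi
    split_ifs at hi with h1 h2
    · refine ⟨(u - N * i) / p, (le_natDegree_of_ne_zero hi).trans_lt hdeg, ?_⟩
      rw [Nat.mul_div_cancel' h2]; omega
    · exact absurd rfl hi
    · exact absurd rfl hi
  by_cases hex : ∃ i ∈ Finset.range M, (if N * i ≤ u then
      if p ∣ u - N * i then P.coeff ((u - N * i) / p) else 0 else 0) ≠ 0
  · obtain ⟨i, hi, hne⟩ := hex
    rw [Finset.sum_eq_single_of_mem i hi]
    · split_ifs
      · exact h _
      · simpa using ha
      · simpa using ha
    · intro i' hi' hii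
      by_contra hne'
      obtain ⟨j, hj, e⟩ := key i hi hne
      obtain ⟨j', hj', e'⟩ := key i' hi' hne'
      have hmod : p * j ≡ p * j' [MOD N] := by
        have : p * j + N * i = p * j' + N * i' := e ▸ e'
        have := congrArg (· % N) this
        simpa [Nat.ModEq] using this
      have hjj : j = j' := by
        have := Nat.ModEq.cancel_left_of_coprime hNp hmod
        rwa [Nat.ModEq, Nat.mod_eq_of_lt hj, Nat.mod_eq_of_lt hj'] at this
      subst hjj
      exact hii (Nat.eq_of_mul_eq_mul_left hN (by omega))
  · push Not at hex
    rw [Finset.sum_eq_zero hex]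
    simpa using ha

/-- As power series, `Φ_{Np} = Φ_N(X^p)/Φ_N = -Φ_N(X^p) (1 + X^N + X^(2N) + ⋯) Ψ`; the first two
factors together have coefficients at most `a`, and multiplying by `Ψ` costs its ℓ¹ norm. The new
cofactor is `Ψ(X^p) Φ_N`, where `Φ_N` has at most `N` coefficients. -/
theorem CycloBound.mul_prime_of_not_dvd {N p : ℕ} {a s : ℤ} (h : CycloBound N a s) (hN : 1 < N)
    (hp : p.Prime) (hd : ¬ p ∣ N) : CycloBound (N * p) (a * s) (s * (a * N)) := by
  obtain ⟨h1, Ψ, h2, h3⟩ := h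
  have ha : 0 ≤ a := (abs_nonneg _).trans (h1 0)
  have he := cyclotomic_expand_eq_cyclotomic_mul hp hd ℤ
  have hco : N.Coprime p := ((Nat.Prime.coprime_iff_not_dvd hp).2 hd).symm
  have hdeg : (cyclotomic N ℤ).natDegree < N := by
    rw [natDegree_cyclotomic]; exact Nat.totient_lt N hN
  refine ⟨fun t => ?_, expand ℤ p Ψ * cyclotomic N ℤ, ?_, ?_⟩
  -- The geometric series is cut after `t + 1` terms; the error has order at least `N(t+1) > t` and
  -- does not reach the coefficient of `X^t`.
  · have hid : cyclotomic (N * p) ℤ * (1 - X ^ (N * (t + 1))) =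
        -((expand ℤ p (cyclotomic N ℤ) * ∑ i ∈ Finset.range (t + 1), (X ^ N) ^ i) * Ψ) := by
      have hg := mul_geom_sum (X ^ N : ℤ[X]) (t + 1)
      rw [he, pow_mul]
      linear_combination cyclotomic (N * p) ℤ * hg +
        cyclotomic (N * p) ℤ * (∑ i ∈ Finset.range (t + 1), (X ^ N) ^ i) * h2
    have hlt : ¬ N * (t + 1) ≤ t := by nlinarith
    have hc := congrArg (fun P : ℤ[X] => |P.coeff t|) hid
    simp only [mul_sub, mul_one, coeff_sub, coeff_mul_X_pow', if_neg hlt, sub_zero, coeff_neg,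
      abs_neg] at hc
    rw [hc]
    exact (abs_coeff_mul_le (abs_coeff_expand_mul_geom_le hp.pos hco hdeg h1) t).trans
      (mul_le_mul_of_nonneg_left h3 ha)
  · calc cyclotomic (N * p) ℤ * (expand ℤ p Ψ * cyclotomic N ℤ)
        = expand ℤ p (cyclotomic N ℤ * Ψ) := by rw [map_mul, he]; ring
      _ = _ := by
        rw [h2]
        simp only [map_sub, map_pow, expand_X, map_one]
        ring
  · refine (l1Norm_mul_le _ _).trans (mul_le_mul ((l1Norm_expand hp.pos Ψ).trans_le h3) ?_
      (l1Norm_nonneg _) ((l1Norm_nonneg _).trans h3))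
    refine (l1Norm_le_mul_of_coeff_le h1).trans ?_
    rw [mul_comm]
    exact mul_le_mul_of_nonneg_left (by exact_mod_cast hdeg) ha

theorem CycloBound.nonneg_left {n : ℕ} {a s : ℤ} (h : CycloBound n a s) : 0 ≤ a :=
  (abs_nonneg _).trans (h.1 0)

theorem CycloBound.nonneg_right {n : ℕ} {a s : ℤ} (h : CycloBound n a s) : 0 ≤ s := by
  obtain ⟨-, Ψ, -, h⟩ := h
  exact (l1Norm_nonneg Ψ).trans h

/-! ### Growth of the coefficient bounds as a power of the order. -/

/-- The exponents `t` in the bound `a * s = O(n ^ t)` for cyclotomic polynomials whose order has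
a given number of prime divisors. -/
noncomputable def cycloExponent : ℕ → ℝ
  | 0 => 0
  | k + 1 => (k : ℝ) / (k + 1) * (2 * cycloExponent k + 1)

theorem cycloExponent_nonneg (k : ℕ) : 0 ≤ cycloExponent k := by
  induction k with
  | zero => exact le_rfl
  | succ k ih => rw [cycloExponent]; positivity

/-- `N` is a product of `k` primes below `p`, so `N ≤ p^k` and `N^(k+1) ≤ (Np)^k`. -/
theorem le_rpow_of_primeFactors_lt {N p : ℕ} (hN : Squarefree N)
    (h : ∀ q ∈ N.primeFactors, q < p) :
    (N : ℝ) ≤ ((N * p : ℕ) : ℝ) ^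
      ((N.primeFactors.card : ℝ) / ((N.primeFactors.card : ℝ) + 1)) := by
  set k := N.primeFactors.card
  have h1 : N ≤ p ^ k := by
    conv_lhs => rw [← Nat.prod_primeFactors_of_squarefree hN]
    exact Finset.prod_le_pow_card _ _ _ fun q hq => (h q hq).le
  have h2 : N ^ (k + 1) ≤ (N * p) ^ k := by
    rw [pow_succ, mul_pow]
    exact Nat.mul_le_mul_left _ h1
  have h3 : (N : ℝ) ^ (k + 1) ≤ ((N * p : ℕ) : ℝ) ^ k := by exact_mod_cast h2
  calc (N : ℝ) = ((N : ℝ) ^ (k + 1)) ^ ((1 : ℝ) / (k + 1)) := by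
        rw [← Real.rpow_natCast, ← Real.rpow_mul (by positivity)]
        push_cast
        rw [mul_one_div_cancel (by positivity), Real.rpow_one]
    _ ≤ (((N * p : ℕ) : ℝ) ^ k) ^ ((1 : ℝ) / (k + 1)) :=
        Real.rpow_le_rpow (by positivity) h3 (by positivity)
    _ = _ := by
        rw [← Real.rpow_natCast, ← Real.rpow_mul (by positivity), mul_one_div]

theorem exists_cycloBound_of_squarefree (k : ℕ) : ∃ K : ℝ, ∀ n : ℕ, Squarefree n →
    n.primeFactors.card = k + 1 → ∃ a s : ℤ, CycloBound n a s ∧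
      (a * s : ℝ) ≤ K * (n : ℝ) ^ cycloExponent (k + 1) := by
  induction k with
  | zero =>
    refine ⟨2, fun n hn hk => ⟨1, 2, ?_, by simp [cycloExponent]⟩⟩
    obtain ⟨p, hp⟩ := Finset.card_eq_one.1 hk
    have hpp : p.Prime := Nat.prime_of_mem_primeFactors (n := n) (by simp [hp])
    have : n = p := by
      rw [← Nat.prod_primeFactors_of_squarefree hn, hp, Finset.prod_singleton]
    rw [this]
    exact cycloBound_prime hpp
  | succ k ih =>
    obtain ⟨K, hK⟩ := ih
    refine ⟨K ^ 2, fun n hn hk => ?_⟩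
    have hne : n.primeFactors.Nonempty := Finset.card_pos.1 (by omega)
    -- Splitting off the largest prime makes the remaining `N`, which enters the bound as a factor,
    -- as small a power of `n` as possible.
    set p := n.primeFactors.max' hne with hp
    have hpm : p ∈ n.primeFactors := Finset.max'_mem _ _
    have hpp : p.Prime := Nat.prime_of_mem_primeFactors hpm
    obtain ⟨N, hN⟩ : ∃ N, n = N * p := by
      obtain ⟨N, hN⟩ := Nat.dvd_of_mem_primeFactors hpm
      exact ⟨N, hN.trans (mul_comm _ _)⟩
    rw [hN] at hn
    have hco : N.Coprime p := Nat.coprime_of_squarefree_mul hn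
    have hNsq : Squarefree N := hn.of_mul_left
    have hdvd : ¬ p ∣ N := (Nat.Prime.coprime_iff_not_dvd hpp).1 hco.symm
    have hpf : n.primeFactors = N.primeFactors ∪ {p} := by
      rw [hN, hco.primeFactors_mul, hpp.primeFactors]
    have hpN : p ∉ N.primeFactors := fun h => hdvd (Nat.dvd_of_mem_primeFactors h)
    have hcard : N.primeFactors.card = k + 1 := by
      rw [hpf, Finset.card_union_of_disjoint (Finset.disjoint_singleton_right.2 hpN),
        Finset.card_singleton] at hk
      omega
    have hlt : ∀ q ∈ N.primeFactors, q < p := fun q hq =>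
      lt_of_le_of_ne (Finset.le_max' _ _ (by rw [hpf]; exact Finset.mem_union_left _ hq))
        fun e => hpN (e ▸ hq)
    have hN1 : 1 < N := by
      by_contra hle
      have : N = 0 ∨ N = 1 := by omega
      rcases this with h | h <;> simp [h] at hcard
    obtain ⟨a, s, hb, hle⟩ := hK N hNsq hcard
    have ha : (0 : ℝ) ≤ a := by exact_mod_cast hb.nonneg_left
    have hs : (0 : ℝ) ≤ s := by exact_mod_cast hb.nonneg_right
    refine ⟨a * s, s * (a * N), hN ▸ hb.mul_prime_of_not_dvd hN1 hpp hdvd, ?_⟩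
    have hroot := le_rpow_of_primeFactors_lt hNsq hlt
    rw [hcard, ← hN] at hroot
    have hN0 : (0 : ℝ) < N := by exact_mod_cast (by omega : 0 < N)
    have ht := cycloExponent_nonneg (k + 1)
    push_cast at hroot ⊢
    calc (a * s * (s * (a * N)) : ℝ) = (a * s) ^ 2 * N := by ring
      _ ≤ (K * (N : ℝ) ^ cycloExponent (k + 1)) ^ 2 * N := by gcongr
      _ = K ^ 2 * (N : ℝ) ^ (2 * cycloExponent (k + 1) + 1) := by
          rw [Real.rpow_add hN0, Real.rpow_one, mul_comm (2 : ℝ), Real.rpow_mul hN0.le,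
            Real.rpow_two]
          ring
      _ ≤ K ^ 2 * ((n : ℝ) ^ (((k : ℝ) + 1) / (k + 1 + 1))) ^
            (2 * cycloExponent (k + 1) + 1) := by gcongr
      _ = _ := by
          rw [← Real.rpow_mul (by positivity), cycloExponent.eq_def (k + 1 + 1)]
          push_cast
          rfl

/-- Removing one copy of a repeated prime keeps the bounds and the set of prime divisors while
decreasing `n`, so the squarefree case suffices. -/
theorem exists_cycloBound (k : ℕ) : ∃ K : ℝ, 0 ≤ K ∧ ∀ n : ℕ,
    n.primeFactors.card = k + 1 → ∃ a s : ℤ, CycloBound n a s ∧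
      (a * s : ℝ) ≤ K * (n : ℝ) ^ cycloExponent (k + 1) := by
  obtain ⟨K, hK⟩ := exists_cycloBound_of_squarefree k
  refine ⟨|K|, abs_nonneg K, fun n => ?_⟩
  induction n using Nat.strong_induction_on with
  | _ n ih =>
  intro hk
  have hn0 : n ≠ 0 := by rintro rfl; simp at hk
  by_cases hsq : Squarefree n
  · obtain ⟨a, s, hb, hle⟩ := hK n hsq hk
    exact ⟨a, s, hb, hle.trans (by gcongr; exact le_abs_self K)⟩
  · rw [Nat.squarefree_iff_prime_squarefree] at hsq
    push Not at hsq
    obtain ⟨p, hp, M, hM⟩ := hsq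
    have hn : n = p * M * p := by rw [hM]; ring
    have hM0 : M ≠ 0 := by rintro rfl; simp at hM; exact hn0 hM
    have hN0 : 0 < p * M := Nat.mul_pos hp.pos (Nat.pos_of_ne_zero hM0)
    have hlt : p * M < n := by rw [hn]; exact lt_mul_of_one_lt_right hN0 hp.one_lt
    have hpf : (p * M).primeFactors = n.primeFactors := by
      rw [hn, Nat.primeFactors_mul hN0.ne' hp.ne_zero, hp.primeFactors,
        Nat.primeFactors_mul hp.ne_zero hM0, hp.primeFactors]
      ext; simp
    obtain ⟨a, s, hb, hle⟩ := ih (p * M) hlt (by rw [hpf, hk])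
    refine ⟨a, s, hn ▸ hb.mul_prime_of_dvd hp (dvd_mul_right p M), hle.trans ?_⟩
    have := cycloExponent_nonneg (k + 1)
    gcongr

/-- From `n ∏(p-1) = φ(n) ∏p` and `p ≤ 2(p-1)`. For a fixed number of prime divisors this replaces
powers of `n` by powers of `φ(n)` at the cost of a constant. -/
theorem le_two_pow_mul_totient (n : ℕ) : n ≤ 2 ^ n.primeFactors.card * n.totient := by
  have h := Nat.totient_mul_prod_primeFactors n
  have hpos : 0 < ∏ p ∈ n.primeFactors, (p - 1) := Finset.prod_pos fun p hp =>
    Nat.sub_pos_of_lt (Nat.prime_of_mem_primeFactors hp).one_lt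
  have hle : ∏ p ∈ n.primeFactors, p ≤ 2 ^ n.primeFactors.card * ∏ p ∈ n.primeFactors, (p - 1) := by
    rw [← Finset.prod_const, ← Finset.prod_mul_distrib]
    refine Finset.prod_le_prod' fun p hp => ?_
    have := (Nat.prime_of_mem_primeFactors hp).two_le
    omega
  refine Nat.le_of_mul_le_mul_right ?_ hpos
  rw [← h]
  calc _ ≤ n.totient * _ := Nat.mul_le_mul_left _ hle
    _ = _ := by ring

/-! ### The inverse of the cyclotomic Vandermonde matrix. -/

/-- Parseval's identity on the cyclic group of order `n`: the exponents in `S` are distinct modulo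
`n`, so the corresponding characters are orthogonal. -/
theorem _root_.IsPrimitiveRoot.sum_norm_sq_sum_mul_pow {ω : ℂ} {n : ℕ} (hω : IsPrimitiveRoot ω n)
    (hn : n ≠ 0) {S : Finset ℕ} (hS : S ⊆ Finset.range n) (c : ℕ → ℂ) :
    ∑ k ∈ Finset.range n, ‖∑ l ∈ S, (ω ^ k) ^ l * c l‖ ^ 2 = n * ∑ l ∈ S, ‖c l‖ ^ 2 := by
  have hω1 : ‖ω‖ = 1 := hω.norm'_eq_one hn
  have hconj : ω * (starRingEnd ℂ) ω = 1 := by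
    rw [Complex.mul_conj', hω1]; simp
  have key : ∀ l ∈ S, ∀ l' ∈ S, ∑ k ∈ Finset.range n,
      (ω ^ l * (starRingEnd ℂ) ω ^ l') ^ k = if l = l' then (n : ℂ) else 0 := by
    intro l hl l' hl'
    split_ifs with h
    · simp [h, ← mul_pow, hconj]
    · have hx : ω ^ l * (starRingEnd ℂ) ω ^ l' ≠ 1 := by
        intro hx
        apply h
        apply hω.pow_inj (Finset.mem_range.1 (hS hl)) (Finset.mem_range.1 (hS hl'))
        calc ω ^ l = ω ^ l * (ω * (starRingEnd ℂ) ω) ^ l' := by rw [hconj]; simp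
          _ = (ω ^ l * (starRingEnd ℂ) ω ^ l') * ω ^ l' := by ring
          _ = _ := by rw [hx, one_mul]
      have hxn : (ω ^ l * (starRingEnd ℂ) ω ^ l') ^ n = 1 := by
        rw [mul_pow, ← pow_mul, ← pow_mul, mul_comm l, mul_comm l', pow_mul, pow_mul,
          ← map_pow, hω.pow_eq_one]
        simp
      have hg := mul_geom_sum (ω ^ l * (starRingEnd ℂ) ω ^ l') n
      rw [hxn, sub_self] at hg
      exact (mul_eq_zero.1 hg).resolve_left (sub_ne_zero.2 hx)
  have main : ∑ k ∈ Finset.range n, (∑ l ∈ S, (ω ^ k) ^ l * c l) *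
      (starRingEnd ℂ) (∑ l ∈ S, (ω ^ k) ^ l * c l) = n * ∑ l ∈ S, c l * (starRingEnd ℂ) (c l) := by
    simp only [map_sum, map_mul, map_pow, Finset.sum_mul_sum]
    rw [Finset.sum_comm, Finset.mul_sum]
    refine Finset.sum_congr rfl fun l hl => ?_
    rw [Finset.sum_comm]
    calc _ = ∑ l' ∈ S, c l * (starRingEnd ℂ) (c l') * ∑ k ∈ Finset.range n,
          (ω ^ l * (starRingEnd ℂ) ω ^ l') ^ k := by
          refine Finset.sum_congr rfl fun l' _ => ?_
          rw [Finset.mul_sum]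
          refine Finset.sum_congr rfl fun k _ => ?_
          ring
      _ = ∑ l' ∈ S, c l * (starRingEnd ℂ) (c l') * if l = l' then (n : ℂ) else 0 :=
          Finset.sum_congr rfl fun l' hl' => by rw [key l hl l' hl']
      _ = _ := by simp [hl]; ring
  simp only [Complex.mul_conj'] at main
  exact_mod_cast main

theorem norm_cycloRoot (n : ℕ) (k : Fin n.totient) : ‖cycloRoot n k‖ = 1 :=
  (isPrimitiveRoot_cycloRoot n k).norm'_eq_one (by have := totative_mem n k; omega)

theorem norm_cycloVandermonde (n : ℕ) : ‖cycloVandermonde n‖ = n.totient := by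
  rw [← sq_eq_sq₀ (norm_nonneg _) (by positivity), frobenius_norm_sq]
  simp [cycloVandermonde, Matrix.vandermonde_apply, norm_cycloRoot, sq]

/-- Nonnegativity allows the sum over primitive roots to be enlarged to all `n`-th roots, where
orthogonality is available. -/
theorem sum_cycloRoot_le (n : ℕ) (f : ℂ → ℝ) (hf : ∀ z, 0 ≤ f z) :
    ∑ i, f (cycloRoot n i) ≤
      ∑ k ∈ Finset.range n, f (Complex.exp (2 * Real.pi * Complex.I / n) ^ k) := by
  have hinj : Function.Injective (totative n) := (Finset.orderEmbOfFin _ rfl).injective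
  have key : ∀ c : Fin n.totient, cycloRoot n c =
      Complex.exp (2 * Real.pi * Complex.I / n) ^ totative n c := by
    intro c
    rw [← Complex.exp_nat_mul, cycloRoot]
    congr 1
    ring
  simp only [key]
  rw [← Finset.sum_image (s := Finset.univ) (g := totative n)
    (f := fun k => f (Complex.exp (2 * Real.pi * Complex.I / n) ^ k)) (fun a _ b _ e => hinj e)]
  refine Finset.sum_le_sum_of_subset_of_nonneg ?_ fun _ _ _ => hf _
  intro k hk
  obtain ⟨i, -, rfl⟩ := Finset.mem_image.1 hk
  exact Finset.mem_range.2 (totative_mem n i).1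

/-- Lagrange interpolation at the primitive roots of unity. -/
theorem cycloVandermonde_inv_apply {n : ℕ} {Ψ : ℤ[X]}
    (hΨ : cyclotomic n ℤ * Ψ = X ^ n - 1) (j i : Fin n.totient) :
    (cycloVandermonde n)⁻¹ j i =
      (cyclotomic n ℂ /ₘ (X - C (cycloRoot n i))).coeff j *
        (cycloRoot n i * aeval (cycloRoot n i) Ψ / n) := by
  have hm : 0 < n.totient := Nat.pos_of_ne_zero fun h => (h ▸ i).elim0
  have hn : 0 < n := Nat.totient_pos.1 hm
  have hn0 : (n : ℂ) ≠ 0 := by exact_mod_cast hn.ne'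
  have : NeZero (n : ℂ) := ⟨hn0⟩
  have hroot : ∀ k, (cyclotomic n ℂ).IsRoot (cycloRoot n k) := fun k =>
    isRoot_cyclotomic_iff.2 (isPrimitiveRoot_cycloRoot n k)
  have hQ : ∀ k, (X - C (cycloRoot n k)) * (cyclotomic n ℂ /ₘ (X - C (cycloRoot n k))) =
      cyclotomic n ℂ := fun k => mul_divByMonic_eq_iff_isRoot.2 (hroot k)
  have hΨ' : cyclotomic n ℂ * Ψ.map (Int.castRingHom ℂ) = X ^ n - 1 := by
    have := congrArg (Polynomial.map (Int.castRingHom ℂ)) hΨ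
    simpa using this
  suffices h : cycloVandermonde n * Matrix.of (fun j i : Fin n.totient =>
      (cyclotomic n ℂ /ₘ (X - C (cycloRoot n i))).coeff j *
        (cycloRoot n i * aeval (cycloRoot n i) Ψ / n)) = 1 by
    rw [Matrix.inv_eq_right_inv h, Matrix.of_apply]
  ext k i
  have hdeg : (cyclotomic n ℂ /ₘ (X - C (cycloRoot n i))).natDegree < n.totient := by
    rw [natDegree_divByMonic _ (monic_X_sub_C _), natDegree_cyclotomic, natDegree_X_sub_C]
    omega
  have hsum : (cycloVandermonde n * Matrix.of (fun j i : Fin n.totient =>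
      (cyclotomic n ℂ /ₘ (X - C (cycloRoot n i))).coeff j *
        (cycloRoot n i * aeval (cycloRoot n i) Ψ / n))) k i =
      eval (cycloRoot n k) (cyclotomic n ℂ /ₘ (X - C (cycloRoot n i))) *
        (cycloRoot n i * aeval (cycloRoot n i) Ψ / n) := by
    rw [eval_eq_sum_range' hdeg, Finset.sum_range, Matrix.mul_apply, Finset.sum_mul]
    refine Finset.sum_congr rfl fun j _ => ?_
    rw [Matrix.of_apply, cycloVandermonde, Matrix.vandermonde_apply]
    ring
  rw [hsum]
  by_cases hki : k = i
  · subst hki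
    -- Differentiating at the root `ζ`: the quotient takes the value `Φ_n'(ζ)`, and `Φ_n'(ζ)Ψ(ζ) =
    -- nζ^(n-1)`. Hence `ζΨ(ζ)/n` is the Lagrange normalisation `1/Φ_n'(ζ)`.
    have h1 := congrArg (fun P => eval (cycloRoot n k) (derivative P)) (hQ k)
    have h2 := congrArg (fun P => eval (cycloRoot n k) (derivative P)) hΨ'
    have h0 : eval (cycloRoot n k) (cyclotomic n ℂ) = 0 := hroot k
    simp only [derivative_mul, eval_add, eval_mul, h0, zero_mul, add_zero, derivative_sub,
      derivative_X_pow, derivative_one, sub_zero, eval_C, eval_pow, eval_X, derivative_X,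
      derivative_C, eval_sub, one_mul, sub_self, eval_natCast, map_natCast] at h1 h2
    rw [Matrix.one_apply_eq, h1, aeval_def, ← eval_map, algebraMap_int_eq]
    calc _ = cycloRoot n k * (eval (cycloRoot n k) (derivative (cyclotomic n ℂ)) *
          eval (cycloRoot n k) (Ψ.map (Int.castRingHom ℂ))) / n := by ring
      _ = cycloRoot n k ^ (n - 1 + 1) := by rw [h2, pow_succ]; field_simp
      _ = 1 := by
        rw [Nat.sub_add_cancel hn, (isPrimitiveRoot_cycloRoot n k).pow_eq_one]
  · rw [Matrix.one_apply_ne hki]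
    have h1 := congrArg (fun P => eval (cycloRoot n k) P) (hQ i)
    have h0 : eval (cycloRoot n k) (cyclotomic n ℂ) = 0 := hroot k
    simp only [eval_mul, eval_sub, eval_X, eval_C, h0] at h1
    rw [(mul_eq_zero.1 h1).resolve_left
      (sub_ne_zero.2 fun e => hki (cycloRoot_injective n e)), zero_mul]

theorem norm_aeval_le_l1Norm {z : ℂ} (hz : ‖z‖ = 1) (P : ℤ[X]) : ‖aeval z P‖ ≤ l1Norm P := by
  rw [aeval_eq_sum_range, l1Norm_eq_sum_of_subset P supp_subset_range_natDegree_succ]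
  push_cast
  refine (norm_sum_le _ _).trans (Finset.sum_le_sum fun i _ => ?_)
  rw [zsmul_eq_mul, norm_mul, norm_pow, hz, one_pow, mul_one, Complex.norm_intCast]

theorem sum_norm_sq_coeff_divByMonic_le {n : ℕ} (hn : 1 < n) {a : ℤ}
    (h : ∀ i, |(cyclotomic n ℤ).coeff i| ≤ a) (j : ℕ) :
    ∑ i, ‖(cyclotomic n ℂ /ₘ (X - C (cycloRoot n i))).coeff j‖ ^ 2 ≤
      n * (n.totient * (a : ℝ) ^ 2) := by
  have hω := Complex.isPrimitiveRoot_exp n (by omega)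
  have hS : Finset.Icc (j + 1) n.totient ⊆ Finset.range n := by
    intro l hl
    have := Nat.totient_lt n hn
    simp at hl ⊢
    omega
  have e : ∀ i, ‖(cyclotomic n ℂ /ₘ (X - C (cycloRoot n i))).coeff j‖ ^ 2 =
      ‖∑ l ∈ Finset.Icc (j + 1) n.totient, cycloRoot n i ^ l * (cyclotomic n ℂ).coeff l‖ ^ 2 := by
    intro i
    congr 1
    rw [coeff_divByMonic_X_sub_C, natDegree_cyclotomic]
    -- Multiplying by `ζ^(j+1)`, of modulus one, turns the coefficient `∑ ζ^(l-j-1) c_l` into a form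
    -- to which Parseval applies.
    rw [← one_mul ‖_‖, ← one_pow (j + 1), ← norm_cycloRoot n i, ← norm_pow, ← norm_mul,
      Finset.mul_sum]
    congr 1
    refine Finset.sum_congr rfl fun l hl => ?_
    rw [← mul_assoc, ← pow_add, Nat.add_sub_cancel' (Finset.mem_Icc.1 hl).1]
  simp only [e]
  refine (sum_cycloRoot_le n (fun z => ‖∑ l ∈ Finset.Icc (j + 1) n.totient,
    z ^ l * (cyclotomic n ℂ).coeff l‖ ^ 2) fun _ => by positivity).trans ?_
  rw [hω.sum_norm_sq_sum_mul_pow (by omega) hS]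
  refine mul_le_mul_of_nonneg_left ?_ (by positivity)
  refine (Finset.sum_le_card_nsmul _ _ ((a : ℝ) ^ 2) fun l _ => ?_).trans ?_
  · rw [← map_cyclotomic_int, coeff_map, eq_intCast, Complex.norm_intCast]
    gcongr
    exact_mod_cast h l
  · rw [nsmul_eq_mul]
    gcongr
    simp

theorem CycloBound.condNumber_cycloVandermonde_le {n : ℕ} {a s : ℤ} (h : CycloBound n a s)
    (hn : 1 < n) :
    condNumber (cycloVandermonde n) ≤ (n.totient : ℝ) * Real.sqrt n.totient * (a * s) := by
  have ha : (0 : ℝ) ≤ a := by exact_mod_cast h.nonneg_left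
  have hs : (0 : ℝ) ≤ s := by exact_mod_cast h.nonneg_right
  obtain ⟨h1, Ψ, h2, h3⟩ := h
  have hn0 : (0 : ℝ) < n := by exact_mod_cast (by omega : 0 < n)
  rw [condNumber, norm_cycloVandermonde, mul_assoc]
  refine mul_le_mul_of_nonneg_left ?_ (by positivity)
  rw [← sq_le_sq₀ (norm_nonneg _) (by positivity), frobenius_norm_sq]
  have hent : ∀ j i, ‖(cycloVandermonde n)⁻¹ j i‖ ^ 2 ≤
      ‖(cyclotomic n ℂ /ₘ (X - C (cycloRoot n i))).coeff j‖ ^ 2 * ((s : ℝ) / n) ^ 2 := by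
    intro j i
    rw [cycloVandermonde_inv_apply h2, norm_mul, mul_pow, norm_div, norm_mul, norm_cycloRoot,
      one_mul, Complex.norm_natCast]
    gcongr
    exact (norm_aeval_le_l1Norm (norm_cycloRoot n i) Ψ).trans (by exact_mod_cast h3)
  calc ∑ j, ∑ i, ‖(cycloVandermonde n)⁻¹ j i‖ ^ 2
      ≤ ∑ _j : Fin n.totient, (n * (n.totient * (a : ℝ) ^ 2)) * ((s : ℝ) / n) ^ 2 := by
        refine Finset.sum_le_sum fun j _ => (Finset.sum_le_sum fun i _ => hent j i).trans ?_
        rw [← Finset.sum_mul]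
        exact mul_le_mul_of_nonneg_right (sum_norm_sq_coeff_divByMonic_le hn h1 j) (by positivity)
    _ = (n.totient * (a * s) ^ 2) * ((n.totient : ℝ) / n) := by
        rw [Finset.sum_const, Finset.card_univ, Fintype.card_fin, nsmul_eq_mul]
        field_simp
    _ ≤ (n.totient * (a * s) ^ 2) * 1 := by
        gcongr
        rw [div_le_one hn0]
        exact_mod_cast Nat.totient_le n
    _ = _ := by
        rw [mul_pow (√_), Real.sq_sqrt (by positivity), mul_one]

theorem exists_condNumber_cycloVandermonde_le (k : ℕ) : ∃ K : ℝ, 0 ≤ K ∧ ∀ n : ℕ,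
    n.primeFactors.card = k + 1 → condNumber (cycloVandermonde n) ≤
      K * (n.totient : ℝ) ^ (3 / 2 + cycloExponent (k + 1)) := by
  obtain ⟨K, hK0, hK⟩ := exists_cycloBound k
  have ht := cycloExponent_nonneg (k + 1)
  refine ⟨K * (2 ^ (k + 1)) ^ cycloExponent (k + 1), by positivity, fun n hk => ?_⟩
  have hn : 1 < n := by
    by_contra hle
    have : n = 0 ∨ n = 1 := by omega
    rcases this with h | h <;> simp [h] at hk
  obtain ⟨a, s, hb, hle⟩ := hK n hk
  have hm : (0 : ℝ) < n.totient := by exact_mod_cast Nat.totient_pos.2 (by omega : 0 < n)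
  have hnm : (n : ℝ) ≤ 2 ^ (k + 1) * n.totient := by
    exact_mod_cast hk ▸ le_two_pow_mul_totient n
  refine (hb.condNumber_cycloVandermonde_le hn).trans ?_
  calc (n.totient : ℝ) * Real.sqrt n.totient * (a * s)
      ≤ (n.totient : ℝ) * Real.sqrt n.totient *
          (K * (2 ^ (k + 1) * n.totient : ℝ) ^ cycloExponent (k + 1)) := by
        refine mul_le_mul_of_nonneg_left (hle.trans ?_) (by positivity)
        gcongr
    _ = _ := by
        rw [Real.mul_rpow (by positivity) hm.le, Real.rpow_add hm, Real.sqrt_eq_rpow,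
          show (3 / 2 : ℝ) = 1 + 1 / 2 by norm_num, Real.rpow_add hm, Real.rpow_one]
        ring

/-! ### Growth of the product of the first primes. -/

/-- A crude consequence of Chebyshev's bounds on `ψ`; any polynomial bound in `r` would serve, since
only the order of magnitude `r log r` of the logarithm of the product matters. -/
theorem nth_prime_le (r : ℕ) : (Nat.nth Nat.Prime r : ℝ) ≤ 25 * ((r : ℝ) + 2) ^ 2 := by
  set p := Nat.nth Nat.Prime r
  have hp : Nat.Prime p := Nat.prime_nth_prime r
  have hp2 : (2 : ℝ) ≤ p := by exact_mod_cast hp.two_le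
  -- `Nat.nth` counts from zero, so `p` is the prime number `r + 1`.
  have hπ : Nat.primeCounting p = r + 1 := by
    rw [Nat.primeCounting, Nat.primeCounting']
    exact Nat.count_nth_succ_of_infinite Nat.infinite_setOfPred_prime r
  have h1 := (Chebyshev.psi_ge p).trans (Chebyshev.psi_le_primeCounting_mul_log p)
  rw [hπ] at h1
  push_cast at h1
  set x := Real.sqrt (p + 1)
  have hx2 : x ^ 2 = p + 1 := Real.sq_sqrt (by linarith)
  have hx : 0 < x := Real.sqrt_pos.2 (by linarith)
  have hlog : Real.log (p + 1) ≤ 2 * x := by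
    rw [← hx2, Real.log_pow]
    have := Real.log_le_sub_one_of_pos hx
    push_cast
    linarith
  have hmono : Real.log p ≤ Real.log (p + 1) := Real.log_le_log (by linarith) (by linarith)
  have hl2 := Real.log_two_gt_d9
  have hr : (0 : ℝ) ≤ r := by positivity
  have h2 : (p : ℝ) * 0.69 ≤ (r + 2) * (2 * x) := by
    have : (p : ℝ) * 0.69 ≤ p * Real.log 2 := by gcongr; linarith
    have : ((r : ℝ) + 1) * Real.log p ≤ (r + 1) * (2 * x) := by gcongr; linarith
    linarith
  have h3 : x ≤ 5 * (r + 2) := by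
    -- As `p ≥ 2`, one has `p ≥ (2/3)x²`, and `0.69 · 2/3 = 0.46`.
    have : x * (x * 0.46) ≤ x * ((r + 2) * 2) := by nlinarith
    have := le_of_mul_le_mul_left this hx
    linarith
  nlinarith

theorem prod_nth_prime_le {r : ℕ} (hr : 3 ≤ r) :
    ∏ i ∈ Finset.range r, (Nat.nth Nat.Prime i : ℝ) ≤ ((r : ℝ) ^ 6) ^ r := by
  have hr' : (3 : ℝ) ≤ r := by exact_mod_cast hr
  have h : ∀ i ∈ Finset.range r, (Nat.nth Nat.Prime i : ℝ) ≤ (r : ℝ) ^ 6 := by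
    intro i hi
    have hi' : (i : ℝ) + 1 ≤ r := by exact_mod_cast Finset.mem_range.1 hi
    have h4 : (3 : ℝ) ^ 4 ≤ (r : ℝ) ^ 4 := by gcongr
    calc (Nat.nth Nat.Prime i : ℝ) ≤ 25 * ((i : ℝ) + 2) ^ 2 := nth_prime_le i
      -- `i + 2 ≤ r + 1 ≤ (4/3)r` because `r ≥ 3`; then `25 · 16/9 < 3^4 ≤ r^4`.
      _ ≤ 25 * ((4 / 3 : ℝ) * r) ^ 2 := by gcongr; linarith
      _ ≤ (r : ℝ) ^ 4 * (r : ℝ) ^ 2 := by nlinarith [sq_nonneg (r : ℝ)]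
      _ = _ := by ring
  exact (Finset.prod_le_prod (fun _ _ => by positivity) h).trans_eq (by simp)

theorem eventually_prod_nth_prime_le {ι : Type*} {l : Filter ι} {r : ι → ℕ} {x : ι → ℝ}
    (hx : Tendsto x l atTop)
    (hr : Tendsto (fun i => (r i : ℝ) * Real.log (Real.sqrt ((r i : ℝ) * Real.log (r i : ℝ))) /
      Real.log (x i)) l (𝓝 0)) :
    ∀ᶠ i in l, ∏ j ∈ Finset.range (r i), (Nat.nth Nat.Prime j : ℝ) ≤ x i := by
  -- For `r ≤ 2` the product is at most `2 · 3 = 6`. For `r ≥ 3` its logarithm is at most `6 r log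
  -- r`, and `log r ≤ 2 log √(r log r)` since `log r ≥ 1`; this gives the factor 12.
  filter_upwards [hx.eventually_ge_atTop 6,
    hr.eventually (Iio_mem_nhds (by norm_num : (0 : ℝ) < 1 / 12))] with i h6 hi
  have hx0 : 0 < x i := by linarith
  have hlogx : 0 < Real.log (x i) := Real.log_pos (by linarith)
  rcases Nat.lt_or_ge (r i) 3 with h3 | h3
  · refine le_trans ?_ h6
    have := Nat.nth_prime_zero_eq_two
    have := Nat.nth_prime_one_eq_three
    interval_cases r i <;> simp_all [Finset.prod_range_succ] <;> norm_num
  · have hr3 : (3 : ℝ) ≤ r i := by exact_mod_cast h3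
    have hL : 1 ≤ Real.log (r i) := by
      rw [Real.le_log_iff_exp_le (by linarith)]
      linarith [Real.exp_one_lt_d9]
    have hs : Real.log (r i) / 2 ≤ Real.log (Real.sqrt ((r i : ℝ) * Real.log (r i : ℝ))) := by
      rw [Real.log_sqrt (by positivity)]
      have : Real.log (r i) ≤ Real.log ((r i : ℝ) * Real.log (r i)) :=
        Real.log_le_log (by linarith) (by nlinarith)
      linarith
    rw [div_lt_iff₀ hlogx] at hi
    have hm : (r i : ℝ) * (Real.log (r i) / 2) ≤
        (r i : ℝ) * Real.log (Real.sqrt ((r i : ℝ) * Real.log (r i : ℝ))) := by gcongr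
    refine (prod_nth_prime_le h3).trans ?_
    rw [← Real.log_le_log_iff (by positivity) hx0, Real.log_pow, Real.log_pow]
    push_cast
    linarith

/-! ### Assembling the bounds. -/

theorem exists_condNumber_hybridMatrix_le (k e : ℕ)
    (he : 2 + cycloExponent (k + 1) ≤ (e : ℝ)) : ∃ K : ℝ, 0 ≤ K ∧ ∀ n r : ℕ,
      ArithmeticFunction.cardDistinctFactors n = k + 1 →
      ∏ j ∈ Finset.range r, (Nat.nth Nat.Prime j : ℝ) ≤ n.totient →
      condNumber (hybridMatrix n r) ≤ K * ((2 : ℝ) ^ r * (n.totient : ℝ)) ^ e := by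
  obtain ⟨K, hK0, hK⟩ := exists_condNumber_cycloVandermonde_le k
  refine ⟨K, hK0, fun n r hω hprod => ?_⟩
  have hn : 1 < n := ArithmeticFunction.cardDistinctFactors_pos.1 (by omega)
  have hm1 : (1 : ℝ) ≤ n.totient := by exact_mod_cast Nat.totient_pos.2 (by omega : 0 < n)
  have hm : (0 : ℝ) < n.totient := by linarith
  have ht := cycloExponent_nonneg (k + 1)
  have he1 : e ≠ 0 := by
    rintro rfl
    push_cast at he
    linarith
  calc condNumber (hybridMatrix n r)
      ≤ condNumber (cycloVandermonde n) *
        (2 ^ r * Real.sqrt (∏ i ∈ Finset.range r, (Nat.nth Nat.Prime i : ℝ))) :=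
        condNumber_hybridMatrix_le n r
    _ ≤ (K * (n.totient : ℝ) ^ (3 / 2 + cycloExponent (k + 1))) *
        (2 ^ r * Real.sqrt n.totient) := by
        gcongr
        exact hK n hω
    _ = K * (2 ^ r * (n.totient : ℝ) ^ (2 + cycloExponent (k + 1))) := by
        rw [show 2 + cycloExponent (k + 1) = (3 / 2 + cycloExponent (k + 1)) + 1 / 2 by ring,
          Real.rpow_add hm _ (1 / 2), Real.sqrt_eq_rpow]
        ring
    _ ≤ K * ((2 ^ r) ^ e * (n.totient : ℝ) ^ (e : ℝ)) := by
        gcongr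
        · exact le_self_pow₀ (one_le_pow₀ (by norm_num)) he1
    _ = _ := by rw [mul_pow, Real.rpow_natCast]

end CycloMultiquadratic

theorem theorem4p6 {ι : Type*} (l : Filter ι) (n r : ι → ℕ)
    (hm : Tendsto (fun i => (n i).totient) l atTop)
    (hr : Tendsto (fun i =>
        (r i : ℝ) * Real.log (Real.sqrt ((r i : ℝ) * Real.log (r i : ℝ))) /
          Real.log ((n i).totient : ℝ)) l (𝓝 0)) :
    ((∀ᶠ i in l, ArithmeticFunction.cardDistinctFactors (n i) ≤ 3) →
      (fun i => CycloMultiquadratic.condNumber (CycloMultiquadratic.hybridMatrix (n i) (r i))) =O[l]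
        (fun i => ((2 : ℝ) ^ r i * ((n i).totient : ℝ)) ^
          (2 + ArithmeticFunction.cardDistinctFactors (n i) - 1))) ∧
    ((∀ᶠ i in l, ArithmeticFunction.cardDistinctFactors (n i) = 4) →
      (fun i => CycloMultiquadratic.condNumber (CycloMultiquadratic.hybridMatrix (n i) (r i))) =O[l]
        (fun i => ((2 : ℝ) ^ r i * ((n i).totient : ℝ)) ^ 6)) ∧
    ((∀ᶠ i in l, ArithmeticFunction.cardDistinctFactors (n i) = 5) →
      (fun i => CycloMultiquadratic.condNumber (CycloMultiquadratic.hybridMatrix (n i) (r i))) =O[l]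
        (fun i => ((2 : ℝ) ^ r i * ((n i).totient : ℝ)) ^ 9)) ∧
    ((∀ᶠ i in l, ArithmeticFunction.cardDistinctFactors (n i) = 6) →
      (fun i => CycloMultiquadratic.condNumber (CycloMultiquadratic.hybridMatrix (n i) (r i))) =O[l]
        (fun i => ((2 : ℝ) ^ r i * ((n i).totient : ℝ)) ^ 13)) := by
  have hm' : Tendsto (fun i => ((n i).totient : ℝ)) l atTop :=
    tendsto_natCast_atTop_atTop.comp hm
  have hprod := CycloMultiquadratic.eventually_prod_nth_prime_le hm' hr
  have hbig : ∀ k e : ℕ, 2 + CycloMultiquadratic.cycloExponent (k + 1) ≤ (e : ℝ) →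
      (∀ᶠ i in l, ArithmeticFunction.cardDistinctFactors (n i) = k + 1) →
      (fun i => CycloMultiquadratic.condNumber (CycloMultiquadratic.hybridMatrix (n i) (r i))) =O[l]
        (fun i => ((2 : ℝ) ^ r i * ((n i).totient : ℝ)) ^ e) := by
    intro k e he hω
    obtain ⟨K, -, hK⟩ := CycloMultiquadratic.exists_condNumber_hybridMatrix_le k e he
    refine IsBigO.of_bound K ?_
    filter_upwards [hω, hprod] with i h1 h2
    rw [Real.norm_of_nonneg (CycloMultiquadratic.condNumber_nonneg _),
      Real.norm_of_nonneg (by positivity)]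
    exact hK _ _ h1 h2
  refine ⟨fun hω => ?_, hbig 3 6 ?_, hbig 4 9 ?_, hbig 5 13 ?_⟩
  · obtain ⟨K₁, h₁, hK₁⟩ := CycloMultiquadratic.exists_condNumber_hybridMatrix_le 0 2
      (by norm_num [CycloMultiquadratic.cycloExponent])
    obtain ⟨K₂, h₂, hK₂⟩ := CycloMultiquadratic.exists_condNumber_hybridMatrix_le 1 3
      (by norm_num [CycloMultiquadratic.cycloExponent])
    obtain ⟨K₃, h₃, hK₃⟩ := CycloMultiquadratic.exists_condNumber_hybridMatrix_le 2 4
      (by norm_num [CycloMultiquadratic.cycloExponent])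
    -- `ω(n)` may vary along the filter, so one constant must cover all three values; `ω(n) = 0` is
    -- excluded once `φ(n) ≥ 2`.
    refine IsBigO.of_bound (K₁ + K₂ + K₃) ?_
    filter_upwards [hω, hprod, hm.eventually_ge_atTop 2] with i h1 h2 h3
    rw [Real.norm_of_nonneg (CycloMultiquadratic.condNumber_nonneg _),
      Real.norm_of_nonneg (by positivity)]
    have hpos : 0 < ArithmeticFunction.cardDistinctFactors (n i) :=
      ArithmeticFunction.cardDistinctFactors_pos.2 (by have := (n i).totient_le; omega)
    obtain h | h | h : ArithmeticFunction.cardDistinctFactors (n i) = 0 + 1 ∨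
        ArithmeticFunction.cardDistinctFactors (n i) = 1 + 1 ∨
        ArithmeticFunction.cardDistinctFactors (n i) = 2 + 1 := by omega
    · rw [h]
      exact (hK₁ _ _ h h2).trans (mul_le_mul_of_nonneg_right (by linarith) (by positivity))
    · rw [h]
      exact (hK₂ _ _ h h2).trans (mul_le_mul_of_nonneg_right (by linarith) (by positivity))
    · rw [h]
      exact (hK₃ _ _ h h2).trans (mul_le_mul_of_nonneg_right (by linarith) (by positivity))
  -- The values of `2 + t` for four, five and six primes are `19/4`, `36/5` and `23/2`.
  all_goals norm_num [CycloMultiquadratic.cycloExponent]
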